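/- A (real) tensor with finite index set $I$ is a function $I\to\mathbb{R}$. A *tensor convolutional network with ReLU activations* is a map $\mathcal N:\mathbb{R}^I\to\mathbb{R}^J$ between tensor spaces that is built, by finitely many compositions and concatenations of parallel branches, from the following layers with real parameters: 1. tensor convolution layers $Y_o=\sum_{k,i}P_{o,k,i}W_kX_i+B_o$, the contraction of the input tensor $X$ with a kernel $W$ along a structure tensor $P$ (which encodes weight sharing), plus a bias tensor $B$ (fully connected layers, reshapings and average pooling are instances); 2. multichannel $d$-dimensional convolution layers with arbitrary kernel sizes, strides, dilations, zero padding and per-channel biases; 3. graph convolution layers $Y=\sum_{k}S_kXW_k+\mathbf 1 b^{\top}$, with propagation matrices $S_k$ on a finite node set and weight matrices $W_k$; 4. recurrent layers, which send a sequence $(x_1,\dots,x_T)$ of fixed finite length to the sequence of hidden states $(h_1,\dots,h_T)$, $h_t=\mathrm{ReLU}(Wx_t+Uh_{t-1}+b)$, with given $h_0$; 5. max-pooling layers over arbitrary non-empty windows; 6. the entrywise activation $\mathrm{ReLU}(a)=\max\{0,a\}$. In particular, graph convolutional, recurrent and convolutional networks with ReLU activations belong to this class. A *ReLU network of depth $3$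 with weights in $\mathbb{R}\cup\{\infty\}$* consists of three hidden layers $\chi^{(l)}=\mathrm{ReLU}(W^{(l)}\chi^{(l-1)}+b^{(l)})$, $l=1,2,3$, of finite widths, with $\chi^{(0)}=x$, and an output layer $\mathcal S(x)=W^{(4)}\chi^{(3)}+b^{(4)}$, where all entries of the $W^{(l)}$ and $b^{(l)}$ lie in $\mathbb{R}\cup\{\infty\}$ and the arithmetic is that of the extended reals, with $\infty\cdot 0=0\cdot\infty=0$, $\infty\cdot a=\infty$ for $a>0$ and $\infty\cdot a=-\infty$ for $a<0$. **Corollary.** For every tensor convolutional network $\mathcal N:\mathbb{R}^I\to\mathbb{R}^J$ with ReLU activations there exists a ReLU network $\mathcal S$ of depth $3$ with weights in $\mathbb{R}\cup\{\infty\}$ such that for all $x\in\mathbb{R}^I$ no sum containing both $\infty$ and $-\infty$ occurs in the evaluation of $\mathcal S$ at $x$, and $$\mathcal S(x)=\mathcal N(x).$$ -/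

import Mathlib

/-- The rectifier on the reals. -/
noncomputable def reluR (a : ℝ) : ℝ := max 0 a

/-! A real tensor with (multi-)index set `ι` is a function `ι → ℝ`; a tensor of order `d` has as index
set a product of `d` finite sets. -/

/-- Tensor convolution: the input tensor `X` is contracted with the kernel (weight tensor) `W` along
the structure tensor `P`, which encodes how the weights are shared between positions, and a bias
tensor `B` is added:  `Y_o = ∑_{k,i} P_{o,k,i} W_k X_i + B_o`. -/
noncomputable def tensorConvMap {ι κ ω : Type} [Fintype ι] [Fintype ω]
    (P : κ → ω → ι → ℝ) (W : ω → ℝ) (B : κ → ℝ) (X : ι → ℝ) : κ → ℝ :=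
  fun o => (∑ k : ω, ∑ i : ι, P o k i * W k * X i) + B o

/-- Value of the zero-padded image `X`, with channels `γ` and spatial extents `s`, in channel `c` at
the integer position `p` (zero outside of the grid). -/
noncomputable def zeroPad {d : ℕ} {γ : Type} (s : Fin d → ℕ)
    (X : γ × ((k : Fin d) → Fin (s k)) → ℝ) (c : γ) (p : Fin d → ℤ) : ℝ :=
  if h : ∀ k, 0 ≤ p k ∧ p k < (s k : ℤ) then
    X (c, fun k => ⟨(p k).toNat, by have := h k; omega⟩)
  else 0

/-- Multichannel `d`-dimensional convolution with kernel `K` of spatial extents `r`, strides, dilations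
and zero padding, and one bias per output channel; `s` and `t` are the spatial extents of the input
and the output. -/
noncomputable def convMap {d : ℕ} {γ γ' : Type} [Fintype γ] (s t r : Fin d → ℕ)
    (stride dilation padding : Fin d → ℕ)
    (K : γ' → γ → ((k : Fin d) → Fin (r k)) → ℝ) (b : γ' → ℝ)
    (X : γ × ((k : Fin d) → Fin (s k)) → ℝ) : γ' × ((k : Fin d) → Fin (t k)) → ℝ :=
  fun o => (∑ c : γ, ∑ q : (k : Fin d) → Fin (r k), K o.1 c q *
    zeroPad s X c (fun k => (stride k : ℤ) * ((o.2 k : ℕ) : ℤ) + (dilation k : ℤ) * ((q k : ℕ) : ℤ)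
      - (padding k : ℤ))) + b o.1

/-- Graph convolution on the node set `V`: `Y = ∑_k S_k X W_k + b`, where `X` is the matrix of node
features, the `S_k` are propagation matrices of the graph (one for the usual layer, namely the
normalised adjacency matrix; several for polynomial filters or several edge types), `W_k` are
weight matrices, and the bias row `b` is added at each node. -/
noncomputable def graphConvMap {V φ φ' : Type} [Fintype V] [Fintype φ] {q : ℕ}
    (S : Fin q → Matrix V V ℝ) (W : Fin q → Matrix φ φ' ℝ) (b : φ' → ℝ)
    (X : V × φ → ℝ) : V × φ' → ℝ :=
  fun o => (∑ k : Fin q, (S k * (Matrix.of fun v f => X (v, f)) * W k) o.1 o.2) + b o.2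

/-- Hidden state after `t` steps of a recurrent layer with ReLU activation, run on a sequence
`X` of length `T`:  `h_0` is given and `h_{t+1} = ReLU (W x_t + U h_t + b)`. -/
noncomputable def rnnState {T : ℕ} {φ η : Type} [Fintype φ] [Fintype η]
    (W : Matrix η φ ℝ) (U : Matrix η η ℝ) (b h₀ : η → ℝ) (X : Fin T × φ → ℝ) : ℕ → η → ℝ
  | 0 => h₀
  | t + 1 => fun j => reluR ((∑ i : φ, W j i * (if h : t < T then X (⟨t, h⟩, i) else 0))
      + (∑ k : η, U j k * rnnState W U b h₀ X t k) + b j)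

/-- Recurrent layer: it returns the sequence of all hidden states `h_1, …, h_T`. -/
noncomputable def rnnMap {T : ℕ} {φ η : Type} [Fintype φ] [Fintype η]
    (W : Matrix η φ ℝ) (U : Matrix η η ℝ) (b h₀ : η → ℝ) (X : Fin T × φ → ℝ) : Fin T × η → ℝ :=
  fun o => rnnState W U b h₀ X ((o.1 : ℕ) + 1) o.2

/-- Max-pooling: entry `o` of the output is the largest entry of the input in the window `win o`. -/
noncomputable def maxPoolMap {ι κ : Type} (win : κ → Finset ι) (hwin : ∀ o, (win o).Nonempty)
    (X : ι → ℝ) : κ → ℝ :=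
  fun o => (win o).sup' (hwin o) X

/-- Tensor convolutional networks with ReLU activations, from tensors indexed by `ι` to tensors
indexed by `κ`: everything that is built from the layers below by finitely many compositions and
concatenations of parallel branches (skip connections, bidirectional recurrent layers). Fully
connected layers, reshapings and average pooling are instances of `tensorConv`. Convolutional, graph convolutional and recurrent
networks use the layers `conv`, `graphConv` and `recurrent`. -/
inductive TensorConvNet : Type → Type → Type 1
  | tensorConv {ι κ ω : Type} [Fintype ι] [Fintype κ] [Fintype ω]
      (P : κ → ω → ι → ℝ) (W : ω → ℝ) (B : κ → ℝ) : TensorConvNet ι κ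
  | conv {d : ℕ} {γ γ' : Type} [Fintype γ] [Fintype γ'] (s t r : Fin d → ℕ)
      (stride dilation padding : Fin d → ℕ)
      (K : γ' → γ → ((k : Fin d) → Fin (r k)) → ℝ) (b : γ' → ℝ) :
      TensorConvNet (γ × ((k : Fin d) → Fin (s k))) (γ' × ((k : Fin d) → Fin (t k)))
  | graphConv {V φ φ' : Type} [Fintype V] [Fintype φ] [Fintype φ'] {q : ℕ}
      (S : Fin q → Matrix V V ℝ) (W : Fin q → Matrix φ φ' ℝ) (b : φ' → ℝ) :
      TensorConvNet (V × φ) (V × φ')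
  | recurrent {T : ℕ} {φ η : Type} [Fintype φ] [Fintype η]
      (W : Matrix η φ ℝ) (U : Matrix η η ℝ) (b h₀ : η → ℝ) :
      TensorConvNet (Fin T × φ) (Fin T × η)
  | maxPool {ι κ : Type} [Fintype ι] [Fintype κ] (win : κ → Finset ι)
      (hwin : ∀ o, (win o).Nonempty) : TensorConvNet ι κ
  | relu {ι : Type} [Fintype ι] : TensorConvNet ι ι
  | comp {ι μ κ : Type} (M : TensorConvNet ι μ) (N : TensorConvNet μ κ) : TensorConvNet ι κ
  | concat {ι κ κ' : Type} (M : TensorConvNet ι κ) (N : TensorConvNet ι κ') :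
      TensorConvNet ι (κ ⊕ κ')

/-- The function computed by a tensor convolutional network. -/
noncomputable def TensorConvNet.eval : {ι κ : Type} → TensorConvNet ι κ → (ι → ℝ) → (κ → ℝ)
  | _, _, @tensorConv _ _ _ _ _ _ P W B => tensorConvMap P W B
  | _, _, @conv _ _ _ _ _ s t r stride dilation padding K b =>
      convMap s t r stride dilation padding K b
  | _, _, @graphConv _ _ _ _ _ _ _ S W b => graphConvMap S W b
  | _, _, @recurrent _ _ _ _ _ W U b h₀ => rnnMap W U b h₀
  | _, _, @maxPool _ _ _ _ win hwin => maxPoolMap win hwin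
  | _, _, @relu _ _ => fun X i => reluR (X i)
  | _, _, @comp _ _ _ M N => fun X => N.eval (M.eval X)
  | _, _, @concat _ _ _ M N => fun X => Sum.elim (M.eval X) (N.eval X)

/-- The weight matrix and the bias vector of one layer, with extended-real entries. -/
structure ExtLayer (ι κ : Type) where
  W : κ → ι → EReal
  b : κ → EReal

namespace ExtLayer

variable {ι κ : Type}

/-- All weights and biases lie in `ℝ ∪ {∞}`. -/
def WeightsInRealTop (L : ExtLayer ι κ) : Prop :=
  (∀ k i, L.W k i ≠ ⊥) ∧ ∀ k, L.b k ≠ ⊥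

/-- `W a + b`, computed in the extended reals (where `∞ * 0 = 0`). -/
noncomputable def affine [Fintype ι] (L : ExtLayer ι κ) (a : ι → EReal) : κ → EReal :=
  fun k => (∑ i : ι, L.W k i * a i) + L.b k

/-- `W a + b` is defined: in no entry both `∞` and `-∞` occur among the summands. -/
def AffineDefined (L : ExtLayer ι κ) (a : ι → EReal) : Prop :=
  ∀ k, ¬ (((∃ i, L.W k i * a i = ⊤) ∨ L.b k = ⊤) ∧ ((∃ i, L.W k i * a i = ⊥) ∨ L.b k = ⊥))

/-- The activations `ReLU (W a + b)`. -/
noncomputable def hidden [Fintype ι] (L : ExtLayer ι κ) (a : ι → EReal) : κ → EReal :=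
  fun k => max 0 (L.affine a k)

end ExtLayer

/-- A ReLU network of depth three (three hidden layers, of widths `n₁`, `n₂`, `n₃`, and an affine output
layer), with extended-real weights. -/
structure ShallowNet (ι κ : Type) where
  n₁ : ℕ
  n₂ : ℕ
  n₃ : ℕ
  layer₁ : ExtLayer ι (Fin n₁)
  layer₂ : ExtLayer (Fin n₁) (Fin n₂)
  layer₃ : ExtLayer (Fin n₂) (Fin n₃)
  output : ExtLayer (Fin n₃) κ

namespace ShallowNet

variable {ι κ : Type}

/-- All weights and biases lie in `ℝ ∪ {∞}`. -/
def WeightsInRealTop (S : ShallowNet ι κ) : Prop :=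
  S.layer₁.WeightsInRealTop ∧ S.layer₂.WeightsInRealTop ∧ S.layer₃.WeightsInRealTop ∧
    S.output.WeightsInRealTop

variable [Fintype ι]

/-- Activations of the first hidden layer. -/
noncomputable def act₁ (S : ShallowNet ι κ) (x : ι → ℝ) : Fin S.n₁ → EReal :=
  S.layer₁.hidden fun i => (x i : EReal)

/-- Activations of the second hidden layer. -/
noncomputable def act₂ (S : ShallowNet ι κ) (x : ι → ℝ) : Fin S.n₂ → EReal :=
  S.layer₂.hidden (S.act₁ x)

/-- Activations of the third hidden layer. -/
noncomputable def act₃ (S : ShallowNet ι κ) (x : ι → ℝ) : Fin S.n₃ → EReal :=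
  S.layer₃.hidden (S.act₂ x)

/-- The output of the network at the real input `x`. -/
noncomputable def eval (S : ShallowNet ι κ) (x : ι → ℝ) : κ → EReal :=
  S.output.affine (S.act₃ x)

/-- No sum of the form `∞ - ∞` occurs when the network is evaluated at `x`. -/
def DefinedAt (S : ShallowNet ι κ) (x : ι → ℝ) : Prop :=
  S.layer₁.AffineDefined (fun i => (x i : EReal)) ∧ S.layer₂.AffineDefined (S.act₁ x) ∧
    S.layer₃.AffineDefined (S.act₂ x) ∧ S.output.AffineDefined (S.act₃ x)

end ShallowNet

/-! Every layer combines its inputs by linear operations, constants, maxima and ReLU, so each output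
entry is a decision tree over affine forms (`TensorConvNet.isPiecewiseAffine_eval`). Such a function
is a linear combination of terms `1_C * ReLU p` with `p` affine and `C` a closed polyhedron
(`IsPiecewiseAffine.mem_cutReluSpan`).

One such term needs three hidden layers. The first computes `ReLU p` and `ReLU a` for all
constraints `a ≤ 0` of `C`. The second keeps `ReLU p` and forms the penalty `∑ ∞ * ReLU a`, which is
`0` on `C` because `∞ * 0 = 0`, and `∞` elsewhere. The third takes `ReLU (ReLU p - penalty)`, which
is the term itself and is finite again, so that a real output layer can form the combination
(`ShallowNet.exists_eval_eq_sum_cutRelu`). -/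

/-! ### Piecewise affine functions -/

/-- The affine form `x ↦ ⟨p.1, x⟩ + p.2`. -/
noncomputable def affForm {ι : Type} [Fintype ι] (p : (ι → ℝ) × ℝ) (x : ι → ℝ) : ℝ :=
  (∑ i, p.1 i * x i) + p.2

/-- Functions computed by a decision tree that branches on the signs of affine forms and has affine
forms at its leaves. -/
inductive IsPiecewiseAffine {ι : Type} [Fintype ι] : ((ι → ℝ) → ℝ) → Prop
  | affine (p : (ι → ℝ) × ℝ) : IsPiecewiseAffine (affForm p)
  | branch (p : (ι → ℝ) × ℝ) {f g : (ι → ℝ) → ℝ} (hf : IsPiecewiseAffine f)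
      (hg : IsPiecewiseAffine g) :
      IsPiecewiseAffine fun x => if affForm p x ≤ 0 then f x else g x

namespace IsPiecewiseAffine

variable {ι : Type} [Fintype ι] {f g : (ι → ℝ) → ℝ}

theorem const (c : ℝ) : IsPiecewiseAffine fun _ : ι → ℝ => c := by
  convert affine ((0 : ι → ℝ), c) using 1
  funext x
  simp [affForm]

theorem coord (i : ι) : IsPiecewiseAffine fun x : ι → ℝ => x i := by
  classical
  convert affine ((Pi.single i 1 : ι → ℝ), 0) using 1
  funext x
  simp [affForm, Pi.single_apply]

theorem const_mul (c : ℝ) (hf : IsPiecewiseAffine f) : IsPiecewiseAffine fun x => c * f x := by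
  induction hf with
  | affine p =>
    convert affine (c • p) using 1
    funext x
    simp [affForm, mul_add, Finset.mul_sum, mul_assoc]
  | branch p _ _ ihf ihg => simpa only [mul_ite] using branch p ihf ihg

/-- The tree of `g` is grafted onto every leaf of the tree of `f`. -/
theorem add (hf : IsPiecewiseAffine f) (hg : IsPiecewiseAffine g) :
    IsPiecewiseAffine fun x => f x + g x := by
  induction hf with
  | affine p =>
    induction hg with
    | affine q =>
      convert affine (p + q) using 1
      funext x
      simp only [affForm, Prod.fst_add, Prod.snd_add, Pi.add_apply, add_mul,
        Finset.sum_add_distrib]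
      ring
    | branch q _ _ ihf ihg => simpa only [add_ite] using branch q ihf ihg
  | branch p _ _ ihf ihg => simpa only [ite_add] using branch p ihf ihg

theorem sum {α : Type} (s : Finset α) {F : α → (ι → ℝ) → ℝ}
    (hF : ∀ a ∈ s, IsPiecewiseAffine (F a)) : IsPiecewiseAffine fun x => ∑ a ∈ s, F a x := by
  induction s using Finset.cons_induction with
  | empty => simpa using const 0
  | cons a s ha ih =>
    simp only [Finset.sum_cons]
    exact (hF a (Finset.mem_cons_self a s)).add
      (ih fun b hb => hF b (Finset.mem_cons_of_mem hb))

theorem relu (hf : IsPiecewiseAffine f) : IsPiecewiseAffine fun x => reluR (f x) := by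
  induction hf with
  | affine p =>
    convert branch p (const 0) (affine p) using 1
    funext x
    split_ifs with h
    · exact max_eq_left h
    · exact max_eq_right (not_le.mp h).le
  | branch p _ _ ihf ihg => simpa only [apply_ite reluR] using branch p ihf ihg

/-- Follows from `f ⊔ g = f + ReLU (g - f)`. -/
theorem max (hf : IsPiecewiseAffine f) (hg : IsPiecewiseAffine g) :
    IsPiecewiseAffine fun x => f x ⊔ g x := by
  convert hf.add (hg.add (hf.const_mul (-1))).relu using 1
  funext x
  rw [reluR, ← max_add_add_left]
  congr 1 <;> ring

theorem sup' {α : Type} {s : Finset α} (hs : s.Nonempty) {F : α → (ι → ℝ) → ℝ}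
    (hF : ∀ a ∈ s, IsPiecewiseAffine (F a)) :
    IsPiecewiseAffine fun x => s.sup' hs fun a => F a x := by
  induction hs using Finset.Nonempty.cons_induction with
  | singleton a => simpa using hF a (Finset.mem_singleton_self a)
  | cons a s ha hs ih =>
    simp only [Finset.sup'_cons hs]
    exact (hF a (Finset.mem_cons_self a s)).max
      (ih fun b hb => hF b (Finset.mem_cons_of_mem hb))

end IsPiecewiseAffine

theorem isPiecewiseAffine_rnnState {ι : Type} [Fintype ι] {T : ℕ} {φ η : Type} [Fintype φ]
    [Fintype η] (W : Matrix η φ ℝ) (U : Matrix η η ℝ) (b h₀ : η → ℝ)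
    {F : (ι → ℝ) → Fin T × φ → ℝ} (hF : ∀ i, IsPiecewiseAffine fun x => F x i) (t : ℕ) (j : η) :
    IsPiecewiseAffine fun x => rnnState W U b h₀ (F x) t j := by
  induction t generalizing j with
  | zero => exact .const _
  | succ t ih =>
    simp only [rnnState]
    refine (((IsPiecewiseAffine.sum _ fun i _ => .const_mul _ ?_).add
      (.sum _ fun k _ => .const_mul _ (ih k))).add (.const _)).relu
    by_cases h : t < T
    · simpa only [h, dite_true] using hF _
    · simpa only [h, dite_false] using .const 0

/-- Tensor convolutional networks map piecewise affine tensors to piecewise affine tensors. -/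
theorem TensorConvNet.isPiecewiseAffine_eval {ι : Type} [Fintype ι] {μ κ : Type}
    (N : TensorConvNet μ κ) {F : (ι → ℝ) → μ → ℝ} (hF : ∀ i, IsPiecewiseAffine fun x => F x i)
    (o : κ) : IsPiecewiseAffine fun x => N.eval (F x) o := by
  induction N with
  | tensorConv P W B =>
    exact (IsPiecewiseAffine.sum _ fun k _ => .sum _ fun i _ => .const_mul _ (hF i)).add (.const _)
  | conv s t r stride dilation padding K b =>
    refine (IsPiecewiseAffine.sum _ fun c _ => .sum _ fun q _ => .const_mul _ ?_).add (.const _)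
    unfold zeroPad
    split_ifs
    · exact hF _
    · exact .const 0
  | graphConv S W b =>
    simp only [TensorConvNet.eval, graphConvMap, Matrix.mul_apply, Matrix.of_apply,
      Finset.sum_mul, mul_assoc]
    refine (IsPiecewiseAffine.sum _ fun k _ => .sum _ fun f _ => .sum _ fun v _ =>
      .const_mul _ ?_).add (.const _)
    simpa only [mul_comm] using (hF (v, f)).const_mul (W k f o.2)
  | recurrent W U b h₀ => exact isPiecewiseAffine_rnnState W U b h₀ hF _ _
  | maxPool win hwin => exact .sup' (hwin o) fun a _ => hF a
  | relu => exact (hF o).relu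
  -- The hypothesis for `N` is used with the output of `M` as its input family; this is why `F` is
  -- arbitrary and not the identity.
  | comp M N ihM ihN => exact ihN (fun i => ihM hF i) o
  | concat M N ihM ihN =>
    cases o with
    | inl o => exact ihM hF o
    | inr o => exact ihN hF o

/-! ### Decomposition into rectified affine forms cut off outside closed polyhedra -/

open Classical in
/-- The rectified affine form `p`, set to zero outside the closed polyhedron `{x | ∀ a ∈ C, a x ≤ 0}`. -/
noncomputable def cutRelu {ι : Type} [Fintype ι] (p : (ι → ℝ) × ℝ) (C : Finset ((ι → ℝ) × ℝ))
    (x : ι → ℝ) : ℝ :=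
  if ∀ a ∈ C, affForm a x ≤ 0 then reluR (affForm p x) else 0

/-- The linear span of the rectified affine forms cut off outside closed polyhedra. -/
noncomputable def cutReluSpan (ι : Type) [Fintype ι] : Submodule ℝ ((ι → ℝ) → ℝ) :=
  Submodule.span ℝ (Set.range fun t : ((ι → ℝ) × ℝ) × Finset ((ι → ℝ) × ℝ) => cutRelu t.1 t.2)

/-- Multiplying by the indicator of a closed half-space is linear and adds just one constraint to
each generator. -/
theorem ite_mem_cutReluSpan {ι : Type} [Fintype ι] (p : (ι → ℝ) × ℝ) {f : (ι → ℝ) → ℝ}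
    (hf : f ∈ cutReluSpan ι) :
    (fun x => if affForm p x ≤ 0 then f x else 0) ∈ cutReluSpan ι := by
  classical
  induction hf using Submodule.span_induction with
  | mem f hf =>
    obtain ⟨⟨q, C⟩, rfl⟩ := hf
    refine Submodule.subset_span ⟨(q, insert p C), ?_⟩
    funext x
    simp only [cutRelu, Finset.forall_mem_insert, ite_and]
  | zero => simp only [Pi.zero_apply, ite_self]; exact Submodule.zero_mem _
  | add f g _ _ ihf ihg =>
    convert Submodule.add_mem _ ihf ihg using 1
    funext x
    simp only [Pi.add_apply]
    split_ifs <;> simp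
  | smul c f _ ih =>
    convert Submodule.smul_mem _ c ih using 1
    funext x
    simp

theorem IsPiecewiseAffine.mem_cutReluSpan {ι : Type} [Fintype ι] {f : (ι → ℝ) → ℝ}
    (hf : IsPiecewiseAffine f) : f ∈ cutReluSpan ι := by
  induction hf with
  | affine p =>
    -- No constraints: this is `a = ReLU a - ReLU (-a)`.
    have h : affForm p = cutRelu p ∅ - cutRelu (-p) ∅ := by
      funext x
      have hneg : affForm (-p) x = -affForm p x := by
        simp [affForm]
        ring
      simp only [Pi.sub_apply, cutRelu, hneg, reluR]
      simp [max_comm]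
    rw [h]
    exact Submodule.sub_mem _ (Submodule.subset_span ⟨(p, ∅), rfl⟩)
      (Submodule.subset_span ⟨(-p, ∅), rfl⟩)
  | @branch p f g _ _ ihf ihg =>
    -- With `H = {p ≤ 0}`, the branch is `1_H f + (g - 1_H g)`; the open half-space `p > 0` is thus
    -- never needed as a constraint.
    convert Submodule.add_mem _ (ite_mem_cutReluSpan p ihf)
      (Submodule.sub_mem _ ihg (ite_mem_cutReluSpan p ihg)) using 1
    funext x
    simp only [Pi.add_apply, Pi.sub_apply]
    split_ifs <;> simp

/-! ### Layers with arbitrary finite index types -/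

namespace ExtLayer

variable {ι κ ι' κ' : Type}

/-- Renaming of the inputs and outputs of a layer. -/
def reindex (e : ι ≃ ι') (f : κ ≃ κ') (L : ExtLayer ι κ) : ExtLayer ι' κ' where
  W k i := L.W (f.symm k) (e.symm i)
  b k := L.b (f.symm k)

theorem WeightsInRealTop.reindex {L : ExtLayer ι κ} (h : L.WeightsInRealTop) (e : ι ≃ ι')
    (f : κ ≃ κ') : (L.reindex e f).WeightsInRealTop :=
  ⟨fun _ _ => h.1 _ _, fun _ => h.2 _⟩

theorem AffineDefined.reindex {L : ExtLayer ι κ} {a : ι → EReal} (h : L.AffineDefined a)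
    (e : ι ≃ ι') (f : κ ≃ κ') : (L.reindex e f).AffineDefined (a ∘ e.symm) := by
  intro k
  have hk := h (f.symm k)
  rwa [← e.symm.exists_congr_right (q := fun i => L.W (f.symm k) i * a i = ⊤),
    ← e.symm.exists_congr_right (q := fun i => L.W (f.symm k) i * a i = ⊥)] at hk

theorem affine_reindex [Fintype ι] [Fintype ι'] (L : ExtLayer ι κ) (e : ι ≃ ι') (f : κ ≃ κ')
    (a : ι → EReal) : (L.reindex e f).affine (a ∘ e.symm) = L.affine a ∘ f.symm := by
  funext k
  exact congrArg (· + _) (e.symm.sum_comp fun i => L.W (f.symm k) i * a i)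

theorem hidden_reindex [Fintype ι] [Fintype ι'] (L : ExtLayer ι κ) (e : ι ≃ ι') (f : κ ≃ κ')
    (a : ι → EReal) : (L.reindex e f).hidden (a ∘ e.symm) = L.hidden a ∘ f.symm := by
  funext k
  simp only [hidden, affine_reindex, Function.comp_apply]

end ExtLayer

/-- Allows neurons to be indexed by sum and sigma types. The activations enter as variables with
equations, so that closed forms can be supplied for them. -/
theorem ShallowNet.exists_of_layers {ι κ A₁ A₂ A₃ : Type} [Fintype ι] [Fintype A₁] [Fintype A₂]
    [Fintype A₃] (L₁ : ExtLayer ι A₁) (L₂ : ExtLayer A₁ A₂) (L₃ : ExtLayer A₂ A₃)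
    (L₄ : ExtLayer A₃ κ) (h₁ : L₁.WeightsInRealTop) (h₂ : L₂.WeightsInRealTop)
    (h₃ : L₃.WeightsInRealTop) (h₄ : L₄.WeightsInRealTop) :
    ∃ S : ShallowNet ι κ, S.WeightsInRealTop ∧ ∀ (x : ι → ℝ) (a₀ : ι → EReal)
      (a₁ : A₁ → EReal) (a₂ : A₂ → EReal) (a₃ : A₃ → EReal), a₀ = (fun i => (x i : EReal)) →
      L₁.hidden a₀ = a₁ → L₂.hidden a₁ = a₂ → L₃.hidden a₂ = a₃ →
      L₁.AffineDefined a₀ → L₂.AffineDefined a₁ → L₃.AffineDefined a₂ → L₄.AffineDefined a₃ →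
      S.DefinedAt x ∧ S.eval x = L₄.affine a₃ := by
  let e₁ := Fintype.equivFin A₁
  let e₂ := Fintype.equivFin A₂
  let e₃ := Fintype.equivFin A₃
  let S : ShallowNet ι κ :=
    { n₁ := _, n₂ := _, n₃ := _
      layer₁ := L₁.reindex (.refl ι) e₁
      layer₂ := L₂.reindex e₁ e₂
      layer₃ := L₃.reindex e₂ e₃
      output := L₄.reindex e₃ (.refl κ) }
  refine ⟨S, ⟨h₁.reindex _ _, h₂.reindex _ _, h₃.reindex _ _, h₄.reindex _ _⟩, ?_⟩
  rintro x _ _ _ _ rfl rfl rfl rfl d₁ d₂ d₃ d₄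
  have s₁ : S.act₁ x = _ := L₁.hidden_reindex (.refl ι) e₁ fun i => (x i : EReal)
  have s₂ : S.act₂ x = _ := (congrArg S.layer₂.hidden s₁).trans (L₂.hidden_reindex e₁ e₂ _)
  have s₃ : S.act₃ x = _ := (congrArg S.layer₃.hidden s₂).trans (L₃.hidden_reindex e₂ e₃ _)
  refine ⟨⟨d₁.reindex (.refl ι) e₁, ?_, ?_, ?_⟩, ?_⟩
  · rw [s₁]; exact d₂.reindex e₁ e₂
  · rw [s₂]; exact d₃.reindex e₂ e₃
  · rw [s₃]; exact d₄.reindex e₃ (.refl κ)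
  · exact (congrArg S.output.affine s₃).trans (L₄.affine_reindex e₃ (.refl κ) _)

/-! ### Real layers -/

/-- The layer with real weights `W` and biases `b`. -/
def ExtLayer.ofReal {ι κ : Type} (W : κ → ι → ℝ) (b : κ → ℝ) : ExtLayer ι κ where
  W k i := (W k i : EReal)
  b k := (b k : EReal)

namespace ExtLayer

variable {ι κ : Type} (W : κ → ι → ℝ) (b : κ → ℝ)

theorem weightsInRealTop_ofReal : (ofReal W b).WeightsInRealTop :=
  ⟨fun _ _ => EReal.coe_ne_bot _, fun _ => EReal.coe_ne_bot _⟩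

theorem affineDefined_ofReal (x : ι → ℝ) :
    (ofReal W b).AffineDefined fun i => (x i : EReal) := by
  rintro k ⟨⟨i, hi⟩ | h, -⟩
  · exact EReal.coe_ne_top (W k i * x i) (by rw [EReal.coe_mul]; exact hi)
  · exact EReal.coe_ne_top _ h

theorem affine_ofReal [Fintype ι] (x : ι → ℝ) (k : κ) :
    (ofReal W b).affine (fun i => (x i : EReal)) k = (((∑ i, W k i * x i) + b k : ℝ) : EReal) := by
  -- Bundled as an additive homomorphism, the coercion commutes with finite sums.
  have h := map_sum (⟨⟨Real.toEReal, EReal.coe_zero⟩, EReal.coe_add⟩ : ℝ →+ EReal)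
    (fun i => W k i * x i) Finset.univ
  simp only [AddMonoidHom.coe_mk, ZeroHom.coe_mk, EReal.coe_mul] at h
  rw [EReal.coe_add, h]
  rfl

end ExtLayer

/-! ### The network of a family of cut-off rectified affine forms -/

open Classical in
theorem ShallowNet.exists_eval_eq_sum_cutRelu {ι κ τ : Type} [Fintype ι] [Fintype τ]
    (p : τ → (ι → ℝ) × ℝ) (C : τ → Finset ((ι → ℝ) × ℝ)) (c : κ → τ → ℝ) :
    ∃ S : ShallowNet ι κ, S.WeightsInRealTop ∧ ∀ x : ι → ℝ, S.DefinedAt x ∧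
      ∀ k, S.eval x k = ((∑ t, c k t * cutRelu (p t) (C t) x : ℝ) : EReal) := by
  -- One first-layer neuron for each pair of a term and one of its constraints.
  let J := Σ t, {a // a ∈ C t}
  let form : τ ⊕ J → (ι → ℝ) × ℝ := Sum.elim p fun j => j.2
  let L₁ : ExtLayer ι (τ ⊕ J) := .ofReal (fun k => (form k).1) fun k => (form k).2
  -- The outputs `inl t` carry the rectified forms, the outputs `inr t` are infinite outside of the
  -- polyhedra.
  let W₂ : τ ⊕ τ → τ ⊕ J → EReal := Sum.elim
    (fun t => Sum.elim (fun s => if s = t then 1 else 0) fun _ => 0)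
    (fun t => Sum.elim (fun _ => 0) fun j => if j.1 = t then ⊤ else 0)
  let L₂ : ExtLayer (τ ⊕ J) (τ ⊕ τ) := ⟨W₂, 0⟩
  -- The weight `-∞` is not allowed, so the penalty is made infinite with weight `∞` in layer two
  -- and subtracted here with weight `-1`.
  let W₃ : τ → τ ⊕ τ → ℝ := fun t =>
    Sum.elim (fun s => if s = t then 1 else 0) fun s => if s = t then -1 else 0
  let L₃ : ExtLayer (τ ⊕ τ) τ := .ofReal W₃ 0
  let L₄ : ExtLayer τ κ := .ofReal c 0
  have hW₂ : ∀ k i, 0 ≤ W₂ k i := by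
    rintro (t | t) (s | j) <;> simp only [W₂, Sum.elim_inl, Sum.elim_inr]
    · split_ifs <;> simp
    · exact le_rfl
    · exact le_rfl
    · split_ifs <;> simp
  have h₂ : L₂.WeightsInRealTop :=
    ⟨fun k i => ne_bot_of_le_ne_bot EReal.zero_ne_bot (hW₂ k i), fun _ => EReal.zero_ne_bot⟩
  obtain ⟨S, hS, hSx⟩ := exists_of_layers L₁ L₂ L₃ L₄ (ExtLayer.weightsInRealTop_ofReal _ _) h₂
    (ExtLayer.weightsInRealTop_ofReal _ _) (ExtLayer.weightsInRealTop_ofReal _ _)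
  refine ⟨S, hS, fun x => ?_⟩
  let r : τ ⊕ J → ℝ := fun k => reluR (affForm (form k) x)
  let a₁ : τ ⊕ J → EReal := fun k => (r k : EReal)
  let pen : τ → EReal := fun t => if ∀ a ∈ C t, affForm a x ≤ 0 then 0 else ⊤
  let a₂ : τ ⊕ τ → EReal := Sum.elim (fun t => (r (.inl t) : EReal)) pen
  let a₃ : τ → EReal := fun t => (cutRelu (p t) (C t) x : EReal)
  have hr : ∀ k, 0 ≤ r k := fun k => le_max_left _ _
  have hprod : ∀ k i, 0 ≤ W₂ k i * a₁ i := fun k i =>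
    mul_nonneg (hW₂ k i) (EReal.coe_nonneg.mpr (hr i))
  have e₁ : L₁.hidden (fun i => (x i : EReal)) = a₁ := by
    funext k
    simp only [ExtLayer.hidden, L₁, ExtLayer.affine_ofReal, a₁, r, reluR, affForm,
      EReal.coe_strictMono.monotone.map_max, EReal.coe_zero]
  have e₂ : L₂.hidden a₁ = a₂ := by
    funext k
    have hk : L₂.hidden a₁ k = ∑ i, W₂ k i * a₁ i := by
      simp only [ExtLayer.hidden, ExtLayer.affine, L₂, Pi.zero_apply, add_zero]
      exact max_eq_right (Finset.sum_nonneg fun i _ => hprod k i)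
    rw [hk]
    rcases k with t | t
    · simp [W₂, a₂, a₁, ite_mul]
    · simp only [a₂, pen, Sum.elim_inr]
      split_ifs with h
      · refine Finset.sum_eq_zero fun i _ => ?_
        rcases i with s | ⟨s, a, ha⟩
        · simp [W₂]
        · simp only [W₂, Sum.elim_inr]
          split_ifs with hs
          · subst hs
            have : r (.inr ⟨s, a, ha⟩) = 0 := max_eq_left (h a ha)
            simp [a₁, this]
          · simp
      · push Not at h
        obtain ⟨a, ha, hpos⟩ := h
        -- All summands are nonnegative, so the violated constraint `a` alone forces the sum to be
        -- `∞`.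
        refine top_unique (le_trans (le_of_eq ?_) (Finset.single_le_sum
          (fun i _ => hprod (.inr t) i) (Finset.mem_univ (.inr ⟨t, a, ha⟩ : τ ⊕ J))))
        have : 0 < r (.inr ⟨t, a, ha⟩) := lt_max_of_lt_right hpos
        simp only [W₂, Sum.elim_inr, if_true, a₁]
        exact (EReal.top_mul_coe_of_pos this).symm
  have e₃ : L₃.hidden a₂ = a₃ := by
    funext t
    have ht : L₃.affine a₂ t = (r (.inl t) : EReal) + -pen t := by
      simp [ExtLayer.affine, L₃, ExtLayer.ofReal, W₃, a₂, apply_ite Real.toEReal, ite_mul]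
    simp only [ExtLayer.hidden, ht, pen, a₃, cutRelu]
    split_ifs with h
    · rw [neg_zero, add_zero]
      exact max_eq_right (EReal.coe_nonneg.mpr (hr (.inl t)))
    -- Outside the polyhedron the preactivation is `-∞`, which ReLU sends to `0`.
    · simp
  have d₂ : L₂.AffineDefined a₁ := by
    rintro k ⟨-, ⟨i, hi⟩ | h⟩
    · exact ne_bot_of_le_ne_bot EReal.zero_ne_bot (hprod k i) hi
    · exact EReal.zero_ne_bot h
  -- No summand is `∞`: the carried values are real, and penalties have weight `0` or `-1`.
  have d₃ : L₃.AffineDefined a₂ := by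
    rintro t ⟨⟨s | s, hs⟩ | h, -⟩
    · exact EReal.coe_ne_top (W₃ t (.inl s) * r (.inl s)) (by rw [EReal.coe_mul]; exact hs)
    · have hpen : 0 ≤ pen s := by simp only [pen]; split_ifs <;> simp
      have hw : ((W₃ t (.inr s) : ℝ) : EReal) ≤ 0 := by
        simp only [W₃, Sum.elim_inr]; split_ifs <;> simp
      have : ((W₃ t (.inr s) : ℝ) : EReal) * pen s ≤ 0 := mul_nonpos_of_nonpos_of_nonneg hw hpen
      exact absurd (hs.symm.le.trans this) (by simp)
    · exact EReal.coe_ne_top _ h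
  obtain ⟨hdef, heval⟩ := hSx x _ a₁ a₂ a₃ rfl e₁ e₂ e₃ (ExtLayer.affineDefined_ofReal _ _ _) d₂ d₃
    (ExtLayer.affineDefined_ofReal _ _ _)
  refine ⟨hdef, fun k => ?_⟩
  rw [heval]
  simpa only [Pi.zero_apply, add_zero] using
    ExtLayer.affine_ofReal c 0 (fun t => cutRelu (p t) (C t) x) k

theorem exists_sum_cutRelu_of_mem_cutReluSpan {ι : Type} [Fintype ι] {f : (ι → ℝ) → ℝ}
    (hf : f ∈ cutReluSpan ι) :
    ∃ (n : ℕ) (c : Fin n → ℝ) (p : Fin n → (ι → ℝ) × ℝ) (C : Fin n → Finset ((ι → ℝ) × ℝ)),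
      ∀ x, f x = ∑ t, c t * cutRelu (p t) (C t) x := by
  obtain ⟨n, c, g, rfl⟩ := Submodule.mem_span_set'.mp hf
  choose u hu using fun t => (g t).2
  refine ⟨n, c, fun t => (u t).1, fun t => (u t).2, fun x => ?_⟩
  simp only [Finset.sum_apply, Pi.smul_apply, smul_eq_mul, ← hu]

theorem mainTheorem4 {ι κ : Type} [Fintype ι] [Fintype κ] (N : TensorConvNet ι κ) :
    ∃ S : ShallowNet ι κ, S.WeightsInRealTop ∧
      ∀ x : ι → ℝ, S.DefinedAt x ∧ ∀ k : κ, S.eval x k = ((N.eval x k : ℝ) : EReal) := by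
  classical
  choose n c p C h using fun k => exists_sum_cutRelu_of_mem_cutReluSpan
    (N.isPiecewiseAffine_eval (F := fun x : ι → ℝ => x) .coord k).mem_cutReluSpan
  obtain ⟨S, hS, hSx⟩ := ShallowNet.exists_eval_eq_sum_cutRelu
    -- The terms of all output entries share one network; each entry gives weight zero to the terms
    -- of the others.
    (τ := Σ k, Fin (n k)) (fun t => p t.1 t.2) (fun t => C t.1 t.2)
    (fun k t => if t.1 = k then c t.1 t.2 else 0)
  refine ⟨S, hS, fun x => ⟨(hSx x).1, fun k => ?_⟩⟩
  rw [(hSx x).2 k, h k x, Fintype.sum_sigma, Finset.sum_eq_single k]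
  · simp
  · intro l _ hl
    simp [hl]
  · simp
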